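/- **Setting.** Let $Z\subseteq\mathbb R^n$ be a non-empty, convex, closed and bounded set, and let $f$ be a convex function (finite on its effective domain $\operatorname{Dom} f$, whose relative interior is non-empty) with $Z\subseteq \operatorname{Dom} f$ and $f$ continuous on $Z$ (automatic if $f$ is finite on all of $\mathbb R^n$). Let $W\in\mathbb R^{m\times k}$ and $q\in\mathbb R^k$, and for a scenario $\xi=(h,T)\in\mathbb R^m\times\mathbb R^{m\times n}$ put $$Q(z,\xi)=\min\{q^\top y: Wy=h-Tz,\ y\ge 0\},\qquad G(z,\xi)=f(z)+Q(z,\xi).$$ Assume that the dual feasibility set $U=\{u\in\mathbb R^m: W^\top u\le q\}$ is non-empty and bounded. Let $\mathcal S$ be a set of scenarios (for instance all of $\mathbb R^m\times\mathbb R^{m\times n}$, or all $(h,T_0)$ with $T_0$ fixed) such that for each $\xi\in\mathcal S$ the problem $\min_{z\in Z}G(z,\xi)$ has a unique optimal solution $z_D^*(\xi)$. Let $\Theta\subset\mathbb R^d$ be non-empty and compact, and let $\Psi(\theta,x)\in\mathcal S$ ($\theta\in\Theta$, $x\in\mathbb R^s$) be a forecast function that is continuous in $\theta\in\Theta$ for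 each $x$ and continuous in $x$ for each $\theta$ (for example, affine in $x$ with coefficients $\theta$). Put $\tilde\pi_D^\theta(x)=z_D^*(\Psi(\theta,x))$. Let $(X_1,\xi_1),(X_2,\xi_2),\dots$ be i.i.d. random elements of $\mathbb R^s\times(\mathbb R^m\times\mathbb R^{m\times n})$ with $\xi_1$ integrable; $(X,\xi)$ denotes a generic copy. Fix a binary decision tree on $\mathbb R^s$ whose inner nodes test inequalities $x_j\le r$; its $R$ leaves determine a fixed partition of $\mathbb R^s$ into regions $\mathcal X_1,\dots,\mathcal X_R$. Let a construction sample of $N'<\infty$ i.i.d. observations with the same law as $(X,\xi)$ be given. For each leaf $\ell$ and each $N$, let $\theta_{\ell N}^*$ be an optimal solution of the bilevel training model on that leaf, $$\min_{\theta\in\Theta}\ \frac1{|I_{\ell N}|}\sum_{i\in I_{\ell N}}G\bigl(z_D^*(\Psi(\theta,X_i)),\xi_i\bigr),\qquad I_{\ell N}=\{i\le N: X_i\in\mathcal X_\ell\},$$ (an arbitrary point of $\Theta$ if $I_{\ell N}=\emptyset$). **Proposition 4.** For almost every realization of the construction sample, every region $\mathcal X_\ell$ that contains one of the $N'$ construction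 observations satisfies the following: $P(X\in\mathcal X_\ell)>0$; the conditional expectations $\mathbb E[G(\tilde\pi_D^\theta(X),\xi)\mid X\in\mathcal X_\ell]$, $\theta\in\Theta$, are well defined and finite; the set $$S_\ell^*=\operatorname*{argmin}_{\theta\in\Theta}\ \mathbb E\bigl[G(\tilde\pi_D^\theta(X),\xi)\mid X\in\mathcal X_\ell\bigr]$$ is non-empty; and, with probability 1, $$\lim_{N\to\infty}d(\theta_{\ell N}^*,S_\ell^*)=0,$$ where $d$ is the Euclidean distance from a point to a set. -/

import Mathlib

open MeasureTheory ProbabilityTheory Filter Topology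
open scoped Matrix

noncomputable section

/-- A scenario `ξ = (h, T)`: a right-hand side `h ∈ ℝ^m` and an `m × n` technology matrix `T`
(given by its entries). -/
abbrev Scenario (m n : ℕ) : Type := (Fin m → ℝ) × (Fin m → Fin n → ℝ)

/-- An observation `(x, ξ)`: a feature vector `x ∈ ℝ^s` and a scenario. -/
abbrev Obs (s m n : ℕ) : Type := (Fin s → ℝ) × Scenario m n

/-- The set of minimizers of `F` over `S`. -/
def argminSet {α : Type*} (F : α → ℝ) (S : Set α) : Set α :=
  {a | a ∈ S ∧ ∀ b ∈ S, F a ≤ F b}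

/-- Data of a two-stage program with fixed recourse and fixed costs. The convex first-stage cost
is given by its effective domain `dom` and its (finite) values `f` there; values of `f` outside
`dom` are irrelevant. -/
structure TwoStage (n m k : ℕ) where
  /-- first-stage feasibility set -/
  Z : Set (Fin n → ℝ)
  /-- effective domain of the first-stage cost -/
  dom : Set (Fin n → ℝ)
  /-- first-stage cost -/
  f : (Fin n → ℝ) → ℝ
  /-- recourse matrix -/
  W : Matrix (Fin m) (Fin k) ℝ
  /-- second-stage cost vector -/
  q : Fin k → ℝ

namespace TwoStage

variable {n m k : ℕ} (M : TwoStage n m k)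

/-- Feasible second-stage decisions: `W y = h - T z`, `y ≥ 0`. -/
def recourseSet (z : Fin n → ℝ) (ξ : Scenario m n) : Set (Fin k → ℝ) :=
  {y | M.W *ᵥ y = ξ.1 - Matrix.of ξ.2 *ᵥ z ∧ 0 ≤ y}

/-- The second-stage value `Q(z, ξ) = min {qᵀ y : W y = h - T z, y ≥ 0}`. When the dual feasible
set is non-empty and bounded, this minimum is finite and attained for all `z` and `ξ`. -/
def Q (z : Fin n → ℝ) (ξ : Scenario m n) : ℝ :=
  sInf ((fun y => M.q ⬝ᵥ y) '' M.recourseSet z ξ)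

/-- The feasible set `{u : Wᵀ u ≤ q}` of the dual of the second-stage problem. -/
def dualSet : Set (Fin m → ℝ) :=
  {u | M.Wᵀ *ᵥ u ≤ M.q}

/-- The total cost `G(z, ξ) = f(z) + Q(z, ξ)`. -/
def G (z : Fin n → ℝ) (ξ : Scenario m n) : ℝ :=
  M.f z + M.Q z ξ

/-- The optimal solutions of the one-scenario problem `min_{z ∈ Z} G(z, ξ)`. -/
def oneScenarioSolutions (ξ : Scenario m n) : Set (Fin n → ℝ) :=
  argminSet (fun z => M.G z ξ) M.Z

/-- The map `z_D^*`: the optimal solution of the one-scenario problem for `ξ`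
(used where that solution is unique). -/
def zD (ξ : Scenario m n) : Fin n → ℝ :=
  Classical.epsilon fun z => z ∈ M.oneScenarioSolutions ξ

/-- The cost `G(z_D^*(Ψ(θ, x)), ξ)`, on the observation `(x, ξ)`, of the policy
`x ↦ z_D^*(Ψ(θ, x))`. -/
def policyCost {s d : ℕ}
    (Ψ : EuclideanSpace ℝ (Fin d) → (Fin s → ℝ) → Scenario m n)
    (θ : EuclideanSpace ℝ (Fin d)) (o : Obs s m n) : ℝ :=
  M.G (M.zD (Ψ θ o.1)) o.2

end TwoStage

/-- Binary decision trees on `ℝ^s`: an inner node tests `x j ≤ r`. -/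
inductive DecisionTree (s : ℕ) : Type
  | leaf : DecisionTree s
  | node (j : Fin s) (r : ℝ) (left right : DecisionTree s) : DecisionTree s

namespace DecisionTree

variable {s : ℕ}

/-- The number `R` of leaves. -/
def numLeaves : DecisionTree s → ℕ
  | leaf => 1
  | node _ _ l r => l.numLeaves + r.numLeaves

/-- The number (in `{0, …, R - 1}`, counting from left to right) of the leaf reached by `x`. -/
def leafIndex : DecisionTree s → (Fin s → ℝ) → ℕ
  | leaf, _ => 0
  | node j c l r, x => if x j ≤ c then l.leafIndex x else l.numLeaves + r.leafIndex x

/-- The region of feature space that belongs to the leaf `ℓ`. -/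
def region (t : DecisionTree s) (ℓ : Fin t.numLeaves) : Set (Fin s → ℝ) :=
  {x | t.leafIndex x = ℓ}

/-- The indices among `0, …, N - 1` of the observations that fall in the leaf `ℓ`. -/
def leafSample {m n : ℕ} (t : DecisionTree s) (ℓ : Fin t.numLeaves) (o : ℕ → Obs s m n) (N : ℕ) :
    Finset ℕ :=
  (Finset.range N).filter fun i => t.leafIndex (o i).1 = ℓ

end DecisionTree

namespace TwoStage

variable {n m k s d : ℕ} (M : TwoStage n m k)

/-- Objective of the bilevel training model on the leaf `ℓ`: the average cost of the policy
with parameter `θ` over those of the first `N` observations that fall in `ℓ`. -/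
def leafObjective (Ψ : EuclideanSpace ℝ (Fin d) → (Fin s → ℝ) → Scenario m n)
    (t : DecisionTree s) (ℓ : Fin t.numLeaves) (o : ℕ → Obs s m n) (N : ℕ)
    (θ : EuclideanSpace ℝ (Fin d)) : ℝ :=
  (1 / ((t.leafSample ℓ o N).card : ℝ)) * ∑ i ∈ t.leafSample ℓ o N, M.policyCost Ψ θ (o i)

/-- The expected cost `E[G(z_D^*(Ψ(θ, X)), ξ) | X ∈ region ℓ]`, for a random observation
`Y = (X, ξ)`, conditional on the region of the leaf `ℓ`. -/
def regionCost {Ω : Type*} [MeasurableSpace Ω] (P : Measure Ω) (Y : Ω → Obs s m n)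
    (Ψ : EuclideanSpace ℝ (Fin d) → (Fin s → ℝ) → Scenario m n)
    (t : DecisionTree s) (ℓ : Fin t.numLeaves) (θ : EuclideanSpace ℝ (Fin d)) : ℝ :=
  ∫ ω, M.policyCost Ψ θ (Y ω) ∂(P[|{ω | (Y ω).1 ∈ t.region ℓ}])

end TwoStage

end

/-! ### The second-stage value function -/

/-! Minimizers are unchanged by positive factors. So the leaf averages, with their random sample
sizes, can be replaced by sums over all observations of the cost cut off outside the leaf
(`leafCost`), and the conditional expectation by an unconditional one. This leaves ordinary sample
average approximation over the compact set `Θ`.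

The cut-off cost is continuous in `θ`: the recourse value is Lipschitz in its right-hand side
(`exists_lipschitzWith_recourseValue`), and the one-scenario solution is continuous by compactness
and uniqueness (`continuousOn_zD`). It is dominated by an integrable envelope (`exists_abs_G_le`).
The strong law in the Banach space of continuous functions on `Θ` therefore gives uniform
convergence (`ae_tendsto_infDist_argminSet_integral`), which carries minimizers to minimizers.
Leaves of probability zero almost surely receive no construction observation. -/

/-- No closedness of `K` is needed: if the interior is non-empty, separate `b` from it; otherwise
`K` spans a proper subspace, on which some non-zero functional vanishes. -/
theorem exists_ne_zero_forall_nonpos_of_convex_cone {E : Type*} [NormedAddCommGroup E]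
    [NormedSpace ℝ E] [FiniteDimensional ℝ E] {K : Set E} (hK : Convex ℝ K) (h0 : (0 : E) ∈ K)
    (hcone : ∀ x ∈ K, ∀ t : ℝ, 0 ≤ t → t • x ∈ K) {b : E} (hb : b ∉ K) :
    ∃ φ : E →ₗ[ℝ] ℝ, φ ≠ 0 ∧ ∀ x ∈ K, φ x ≤ 0 := by
  by_cases hint : (interior K).Nonempty
  · obtain ⟨φ, hφ⟩ := geometric_hahn_banach_open_point hK.interior isOpen_interior
      (fun h => hb (interior_subset h))
    have hle : ∀ x ∈ K, φ x ≤ φ b := by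
      intro x hx
      have hx' : x ∈ closure (interior K) := by
        rw [hK.closure_interior_eq_closure_of_nonempty_interior hint]
        exact subset_closure hx
      exact closure_minimal (fun a ha => (hφ a ha).le)
        (isClosed_le φ.continuous continuous_const) hx'
    refine ⟨φ.toLinearMap, ?_, fun x hx => ?_⟩
    · rintro h
      obtain ⟨a, ha⟩ := hint
      have h1 := hφ a ha
      have h2 : ∀ x, φ x = 0 := fun x => LinearMap.congr_fun h x
      simp [h2] at h1
    · by_contra! hpos
      change 0 < φ x at hpos
      have hb0 : 0 ≤ φ b := by simpa using hle 0 h0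
      -- This multiple of `x` has `φ`-value `φ b + 1`, above the bound `φ b`.
      have h1 := hle _ (hcone x hx ((φ b + 1) / φ x) (by positivity))
      rw [map_smul, smul_eq_mul, div_mul_cancel₀ _ hpos.ne'] at h1
      linarith
  · have hspan : Submodule.span ℝ K < ⊤ := by
      refine lt_top_iff_ne_top.2 fun h => hint ?_
      rw [hK.interior_nonempty_iff_affineSpan_eq_top]
      apply SetLike.coe_injective
      rw [← Set.insert_eq_of_mem h0, affineSpan_insert_zero, h]
      rfl
    obtain ⟨φ, hφ, hle⟩ := Submodule.exists_le_ker_of_lt_top _ hspan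
    exact ⟨φ, hφ, fun x hx => (LinearMap.mem_ker.1 (hle (Submodule.subset_span hx))).le⟩

namespace TwoStage

variable {n m k : ℕ} (M : TwoStage n m k)

/-- The value of the second-stage problem as a function of its right-hand side. -/
noncomputable def recourseValue (b : Fin m → ℝ) : ℝ :=
  sInf ((fun y => M.q ⬝ᵥ y) '' {y | M.W *ᵥ y = b ∧ 0 ≤ y})

theorem Q_eq_recourseValue (z : Fin n → ℝ) (ξ : Scenario m n) :
    M.Q z ξ = M.recourseValue (ξ.1 - Matrix.of ξ.2 *ᵥ z) := rfl

variable {M}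

/-- An unreachable `b` would yield `u ≠ 0` with `Wᵀ u ≤ 0`, a recession direction of the dual set,
contradicting boundedness. -/
theorem exists_nonneg_mulVec_eq (hU : M.dualSet.Nonempty)
    (hb : Bornology.IsBounded M.dualSet) (b : Fin m → ℝ) : ∃ y, M.W *ᵥ y = b ∧ 0 ≤ y := by
  by_contra hne
  have hconv : Convex ℝ (M.W.mulVecLin '' Set.Ici 0) := (convex_Ici 0).linear_image _
  obtain ⟨φ, hφ, hle⟩ := exists_ne_zero_forall_nonpos_of_convex_cone hconv
    ⟨0, Set.mem_Ici.2 le_rfl, map_zero _⟩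
    (by
      rintro _ ⟨y, hy, rfl⟩ t ht
      exact ⟨t • y, Set.mem_Ici.2 (smul_nonneg ht (Set.mem_Ici.1 hy)), map_smul _ _ _⟩)
    (b := b) (by
      rintro ⟨y, hy, rfl⟩
      exact hne ⟨y, rfl, hy⟩)
  let u : Fin m → ℝ := fun i => φ (Pi.single i 1)
  have hφu : ∀ x, φ x = u ⬝ᵥ x := by
    intro x
    conv_lhs => rw [← Finset.univ_sum_single x]
    rw [map_sum]
    refine Finset.sum_congr rfl fun i _ => ?_
    have : (Pi.single i (x i) : Fin m → ℝ) = x i • Pi.single i 1 := by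
      rw [← Pi.single_smul]; simp
    rw [this, map_smul, smul_eq_mul, mul_comm]
  have hu : u ≠ 0 := by
    intro h
    exact hφ (LinearMap.ext fun x => by rw [hφu, h]; simp)
  have hWu : ∀ j, (M.Wᵀ *ᵥ u) j ≤ 0 := by
    intro j
    have h1 := hle _ ⟨Pi.single j 1, Set.mem_Ici.2 (Pi.single_nonneg.2 zero_le_one), rfl⟩
    rw [hφu, Matrix.mulVecLin_apply, Matrix.dotProduct_mulVec, ← Matrix.mulVec_transpose] at h1
    simpa using h1
  obtain ⟨u₀, hu₀⟩ := hU
  obtain ⟨r, hr⟩ := hb.exists_norm_le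
  have hmem : ∀ t : ℝ, 0 ≤ t → u₀ + t • u ∈ M.dualSet := by
    intro t ht j
    have h1 := hu₀ j
    have h2 := mul_nonpos_of_nonneg_of_nonpos ht (hWu j)
    simp only [Matrix.mulVec_add, Matrix.mulVec_smul, Pi.add_apply, Pi.smul_apply, smul_eq_mul]
    linarith
  have hpos : 0 < ‖u‖ := norm_pos_iff.2 hu
  have hr0 : 0 ≤ r := (norm_nonneg _).trans (hr _ hu₀)
  -- A step of length `2 * r + 1` is longer than the distance `2 * r` possible inside the ball of
  -- radius `r`.
  have ht : 0 ≤ (2 * r + 1) / ‖u‖ := by positivity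
  have h1 := hr _ (hmem _ ht)
  have h2 := hr _ hu₀
  have h3 : ‖((2 * r + 1) / ‖u‖) • u‖ = 2 * r + 1 := by
    rw [norm_smul, Real.norm_of_nonneg ht, div_mul_cancel₀ _ hpos.ne']
  have h4 := norm_sub_le (u₀ + ((2 * r + 1) / ‖u‖) • u) u₀
  rw [add_sub_cancel_left, h3] at h4
  linarith

/-- Weak duality. -/
theorem bddBelow_recourse (hU : M.dualSet.Nonempty) (b : Fin m → ℝ) :
    BddBelow ((fun y => M.q ⬝ᵥ y) '' {y | M.W *ᵥ y = b ∧ 0 ≤ y}) := by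
  obtain ⟨u, hu⟩ := hU
  refine ⟨u ⬝ᵥ b, ?_⟩
  rintro _ ⟨y, ⟨rfl, hy⟩, rfl⟩
  rw [Matrix.dotProduct_mulVec, ← Matrix.mulVec_transpose]
  exact Finset.sum_le_sum fun j _ => mul_le_mul_of_nonneg_right (hu j) (hy j)

theorem recourseValue_add_le (hU : M.dualSet.Nonempty) (hb : Bornology.IsBounded M.dualSet)
    (b b' : Fin m → ℝ) :
    M.recourseValue (b + b') ≤ M.recourseValue b + M.recourseValue b' := by
  have hne : ∀ b, ((fun y => M.q ⬝ᵥ y) '' {y | M.W *ᵥ y = b ∧ 0 ≤ y}).Nonempty := fun b =>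
    Set.Nonempty.image _ (exists_nonneg_mulVec_eq hU hb b)
  refine le_of_forall_pos_le_add fun ε hε => ?_
  obtain ⟨_, ⟨y, ⟨hy, hy0⟩, rfl⟩, h1⟩ := Real.lt_sInf_add_pos (hne b) (half_pos hε)
  obtain ⟨_, ⟨y', ⟨hy', hy0'⟩, rfl⟩, h2⟩ := Real.lt_sInf_add_pos (hne b') (half_pos hε)
  have h3 : M.recourseValue (b + b') ≤ M.q ⬝ᵥ (y + y') :=
    csInf_le (bddBelow_recourse hU _)
      ⟨_, ⟨by rw [Matrix.mulVec_add, hy, hy'], add_nonneg hy0 hy0'⟩, rfl⟩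
  rw [dotProduct_add] at h3
  simp only [recourseValue] at h3 ⊢
  linarith

/-- Fixed recourse decisions for the vectors `±eᵢ`, weighted by the positive and negative parts of
`b i`, combine to a feasible decision for `b`. -/
theorem exists_recourseValue_le (hU : M.dualSet.Nonempty) (hb : Bornology.IsBounded M.dualSet) :
    ∃ c : ℝ, 0 ≤ c ∧ ∀ b, M.recourseValue b ≤ c * ‖b‖ := by
  choose y hy hy0 using exists_nonneg_mulVec_eq hU hb
  let e : Fin m → Fin m → ℝ := fun i => Pi.single i 1
  refine ⟨∑ i, (|M.q ⬝ᵥ y (e i)| + |M.q ⬝ᵥ y (-e i)|), by positivity, fun b => ?_⟩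
  have hfeas : M.recourseValue b ≤
      M.q ⬝ᵥ ∑ i, ((b i)⁺ • y (e i) + (b i)⁻ • y (-e i)) := by
    refine csInf_le (bddBelow_recourse hU _) ⟨_, ⟨?_, ?_⟩, rfl⟩
    · rw [Matrix.mulVec_sum]
      conv_rhs => rw [← Finset.univ_sum_single b]
      refine Finset.sum_congr rfl fun i _ => ?_
      rw [Matrix.mulVec_add, Matrix.mulVec_smul, Matrix.mulVec_smul, hy, hy, smul_neg,
        ← sub_eq_add_neg, ← sub_smul, posPart_sub_negPart, ← Pi.single_smul]
      simp
    · exact Finset.sum_nonneg fun i _ => add_nonneg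
        (smul_nonneg (posPart_nonneg _) (hy0 _)) (smul_nonneg (negPart_nonneg _) (hy0 _))
  refine hfeas.trans ?_
  rw [dotProduct_sum, Finset.sum_mul]
  refine Finset.sum_le_sum fun i _ => ?_
  rw [dotProduct_add, dotProduct_smul, dotProduct_smul, smul_eq_mul, smul_eq_mul, add_mul,
    mul_comm _ ‖b‖, mul_comm _ ‖b‖]
  have hbi : |b i| ≤ ‖b‖ := norm_le_pi_norm b i
  have hp : (b i)⁺ ≤ ‖b‖ := (sup_le (le_abs_self _) (abs_nonneg _)).trans hbi
  have hn : (b i)⁻ ≤ ‖b‖ := (sup_le (neg_le_abs _) (abs_nonneg _)).trans hbi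
  exact add_le_add
    ((mul_le_mul_of_nonneg_left (le_abs_self _) (posPart_nonneg _)).trans
      (mul_le_mul_of_nonneg_right hp (abs_nonneg _)))
    ((mul_le_mul_of_nonneg_left (le_abs_self _) (negPart_nonneg _)).trans
      (mul_le_mul_of_nonneg_right hn (abs_nonneg _)))

/-- Subadditivity applied to `b = b' + (b - b')`, with linear growth bounding the second term.
Strong duality is not needed. -/
theorem exists_lipschitzWith_recourseValue (hU : M.dualSet.Nonempty)
    (hb : Bornology.IsBounded M.dualSet) : ∃ c, LipschitzWith c M.recourseValue := by
  obtain ⟨c, hc, h⟩ := exists_recourseValue_le hU hb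
  refine ⟨⟨c, hc⟩, LipschitzWith.of_le_add_mul _ fun b b' => ?_⟩
  have h1 := recourseValue_add_le hU hb b' (b - b')
  rw [add_sub_cancel] at h1
  rw [dist_eq_norm]
  exact h1.trans (add_le_add le_rfl (h _))

/-! ### Regularity of the cost and of the one-scenario solutions -/

theorem continuousOn_G (hU : M.dualSet.Nonempty) (hb : Bornology.IsBounded M.dualSet)
    (hf : ContinuousOn M.f M.Z) :
    ContinuousOn (fun p : (Fin n → ℝ) × Scenario m n => M.G p.1 p.2) (M.Z ×ˢ Set.univ) := by
  obtain ⟨c, hc⟩ := exists_lipschitzWith_recourseValue hU hb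
  refine ContinuousOn.add (hf.comp continuousOn_fst fun p hp => hp.1) ?_
  refine (hc.continuous.comp ?_).continuousOn
  refine Continuous.sub (by fun_prop) ?_
  refine Continuous.matrix_mulVec ?_ continuous_fst
  exact continuous_matrix fun i j => by
    simp only [Matrix.of_apply]
    fun_prop

/-- Provides the integrable envelope for the policy costs, uniform in the parameter. -/
theorem exists_abs_G_le (hU : M.dualSet.Nonempty) (hb : Bornology.IsBounded M.dualSet)
    (hZ : IsCompact M.Z) (hf : ContinuousOn M.f M.Z) :
    ∃ a c : ℝ, ∀ z ∈ M.Z, ∀ ξ, |M.G z ξ| ≤ a + c * ‖ξ‖ := by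
  obtain ⟨L, hL⟩ := exists_lipschitzWith_recourseValue hU hb
  obtain ⟨a, ha⟩ := hZ.exists_bound_of_continuousOn hf
  obtain ⟨r, hr⟩ := hZ.isBounded.exists_norm_le
  refine ⟨a + |M.recourseValue 0|, L * (1 + n * r), fun z hz ξ => ?_⟩
  have h1 : ‖ξ.1 - Matrix.of ξ.2 *ᵥ z‖ ≤ (1 + n * r) * ‖ξ‖ := by
    have hr0 : 0 ≤ r := (norm_nonneg _).trans (hr z hz)
    rw [add_mul, one_mul]
    refine (norm_sub_le _ _).trans (add_le_add (norm_fst_le ξ) ?_)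
    refine (pi_norm_le_iff_of_nonneg (by positivity)).2 fun i => ?_
    change ‖∑ j, ξ.2 i j * z j‖ ≤ _
    refine (norm_sum_le _ _).trans ?_
    refine (Finset.sum_le_card_nsmul _ _ (‖ξ‖ * r) fun j _ => ?_).trans ?_
    · rw [norm_mul]
      refine mul_le_mul ?_ ((norm_le_pi_norm z j).trans (hr z hz)) (norm_nonneg _) (norm_nonneg _)
      exact ((norm_le_pi_norm (ξ.2 i) j).trans (norm_le_pi_norm ξ.2 i)).trans (norm_snd_le ξ)
    · simp only [Finset.card_univ, Fintype.card_fin, nsmul_eq_mul]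
      exact le_of_eq (by ring)
  have h2 := hL.dist_le_mul (ξ.1 - Matrix.of ξ.2 *ᵥ z) 0
  rw [dist_zero_right, Real.dist_eq, ← Q_eq_recourseValue] at h2
  have h3 : (L : ℝ) * ‖ξ.1 - Matrix.of ξ.2 *ᵥ z‖ ≤ L * ((1 + n * r) * ‖ξ‖) :=
    mul_le_mul_of_nonneg_left h1 L.2
  have h4 := ha z hz
  rw [Real.norm_eq_abs] at h4
  have h5 := abs_add_le (M.f z) (M.Q z ξ)
  have h6 := abs_sub_abs_le_abs_sub (M.Q z ξ) (M.recourseValue 0)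
  change |M.f z + M.Q z ξ| ≤ _
  linarith

theorem zD_mem {ξ : Scenario m n} (h : ∃! z, z ∈ M.oneScenarioSolutions ξ) :
    M.zD ξ ∈ M.oneScenarioSolutions ξ :=
  Classical.epsilon_spec h.exists

/-- By joint continuity of `G`, optimality passes to every cluster point of `zD η` as `η → ξ`;
uniqueness leaves one cluster point, and compactness turns this into convergence. -/
theorem continuousOn_zD (hU : M.dualSet.Nonempty) (hb : Bornology.IsBounded M.dualSet)
    (hZ : IsCompact M.Z) (hf : ContinuousOn M.f M.Z) {S : Set (Scenario m n)}
    (hS : ∀ ξ ∈ S, ∃! z, z ∈ M.oneScenarioSolutions ξ) : ContinuousOn M.zD S := by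
  intro ξ hξ
  have hG := continuousOn_G hU hb hf
  refine hZ.tendsto_nhds_of_unique_mapClusterPt
    (eventually_mem_nhdsWithin.mono fun η hη => (zD_mem (hS η hη)).1) fun z hz hcl => ?_
  refine (hS ξ hξ).unique ⟨hz, fun b hbZ => ?_⟩ (zD_mem (hS ξ hξ))
  obtain ⟨𝒰, h𝒰, hlim⟩ := mapClusterPt_iff_ultrafilter.1 hcl
  have hmem : ∀ᶠ η in (𝒰 : Filter (Scenario m n)), η ∈ S :=
    h𝒰 eventually_mem_nhdsWithin
  have hid : Tendsto id (𝒰 : Filter (Scenario m n)) (𝓝 ξ) :=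
    h𝒰.trans nhdsWithin_le_nhds
  have hlim1 : Tendsto (fun η => M.G (M.zD η) η) 𝒰 (𝓝 (M.G z ξ)) :=
    (hG (z, ξ) ⟨hz, trivial⟩).tendsto.comp (tendsto_nhdsWithin_iff.2
      ⟨hlim.prodMk_nhds hid, hmem.mono fun η hη => ⟨(zD_mem (hS η hη)).1, trivial⟩⟩)
  have hlim2 : Tendsto (fun η => M.G b η) 𝒰 (𝓝 (M.G b ξ)) :=
    (hG (b, ξ) ⟨hbZ, trivial⟩).tendsto.comp (tendsto_nhdsWithin_iff.2
      ⟨tendsto_const_nhds.prodMk_nhds hid, Eventually.of_forall fun η => ⟨hbZ, trivial⟩⟩)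
  exact le_of_tendsto_of_tendsto hlim1 hlim2
    (hmem.mono fun η hη => (zD_mem (hS η hη)).2 b hbZ)

end TwoStage

/-! ### Sample average approximation over a compact set -/

theorem argminSet_nonempty {X : Type*} [TopologicalSpace X] {K : Set X} (hK : IsCompact K)
    (hne : K.Nonempty) {F : X → ℝ} (hF : ContinuousOn F K) : (argminSet F K).Nonempty := by
  obtain ⟨x, hx, hmin⟩ := hK.exists_isMinOn hne hF
  exact ⟨x, hx, fun b hb => hmin hb⟩

theorem argminSet_congr {X : Type*} {K : Set X} {F F' : X → ℝ} (h : Set.EqOn F F' K) :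
    argminSet F K = argminSet F' K := by
  ext a
  refine and_congr_right fun ha => forall₂_congr fun b hb => ?_
  rw [h ha, h hb]

theorem argminSet_const_mul {X : Type*} {K : Set X} {F : X → ℝ} {c : ℝ} (hc : 0 < c) :
    argminSet (fun x => c * F x) K = argminSet F K := by
  ext a
  exact and_congr_right fun _ => forall₂_congr fun b _ => mul_le_mul_iff_right₀ hc

/-- If continuous functions converge uniformly on a compact set, then their minimizers approach
the minimizers of the limit. -/
theorem tendsto_infDist_argminSet {X : Type*} [PseudoMetricSpace X] {K : Set X} (hK : IsCompact K)
    {F : ℕ → X → ℝ} {f : X → ℝ} (hf : ContinuousOn f K) (h : TendstoUniformlyOn F f atTop K)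
    {x : ℕ → X} (hx : ∀ N, x N ∈ argminSet (F N) K) :
    Tendsto (fun N => Metric.infDist (x N) (argminSet f K)) atTop (𝓝 0) := by
  have hcl : Tendsto x atTop (𝓝ˢ (argminSet f K)) := by
    refine hK.tendsto_nhdsSet_of_mapClusterPt (Eventually.of_forall fun N => (hx N).1)
      fun a ha hcl => ⟨ha, fun b hb => ?_⟩
    obtain ⟨𝒰, h𝒰, hlim⟩ := mapClusterPt_iff_ultrafilter.1 hcl
    have hunif : TendstoUniformlyOn F f (𝒰 : Filter ℕ) K := fun u hu => h𝒰 (h u hu)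
    have hxK : Tendsto x 𝒰 (𝓝[K] a) :=
      tendsto_nhdsWithin_iff.2 ⟨hlim, Eventually.of_forall fun N => (hx N).1⟩
    -- Uniformity is what allows evaluation at the moving point `x N`.
    have hdiff : Tendsto (fun N => F N (x N) - f (x N)) 𝒰 (𝓝 0) := by
      rw [Metric.tendsto_nhds]
      intro ε hε
      filter_upwards [Metric.tendstoUniformlyOn_iff.1 hunif ε hε] with N hN
      have := hN (x N) (hx N).1
      rwa [dist_comm, Real.dist_eq, ← Real.norm_eq_abs, ← dist_zero_right] at this
    have hlim1 : Tendsto (fun N => F N (x N)) 𝒰 (𝓝 (f a)) := by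
      simpa using hdiff.add ((hf a ha).tendsto.comp hxK)
    exact le_of_tendsto_of_tendsto' hlim1 (hunif.tendsto_at hb) fun N => (hx N).2 b hb
  intro s hs
  change ∀ᶠ N in atTop, Metric.infDist (x N) (argminSet f K) ∈ s
  refine hcl.eventually (p := fun y => Metric.infDist y (argminSet f K) ∈ s)
    (mem_nhdsSet_iff_forall.2 fun a ha => ?_)
  have hcont := (Metric.continuous_infDist_pt (argminSet f K)).tendsto a
  rw [Metric.infDist_zero_of_mem ha] at hcont
  exact hcont hs

/-- Evaluation along a dense sequence is a continuous injection of a Polish space, hence a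
measurable embedding by Lusin–Souslin, so measurability can be tested on evaluations. -/
theorem measurable_continuousMap_of_eval {X A : Type*} [TopologicalSpace X]
    [CompactSpace X] [SecondCountableTopology X] [T2Space X] [MeasurableSpace A] {g : A → C(X, ℝ)}
    (hg : ∀ x, Measurable fun a => g a x) : @Measurable _ _ _ (borel C(X, ℝ)) g := by
  borelize C(X, ℝ)
  cases isEmpty_or_nonempty X
  · have : g = fun _ => 0 := by
      funext a
      ext x
      exact isEmptyElim x
    rw [this]
    exact measurable_const
  have := TopologicalSpace.MetrizableSpace X
  have hcont : Continuous fun (u : C(X, ℝ)) (i : ℕ) => u (TopologicalSpace.denseSeq X i) :=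
    continuous_pi fun i => continuous_eval_const _
  have hinj : Function.Injective
      fun (u : C(X, ℝ)) (i : ℕ) => u (TopologicalSpace.denseSeq X i) := by
    intro u v huv
    refine DFunLike.coe_injective (Continuous.ext_on (TopologicalSpace.denseRange_denseSeq X)
      u.continuous v.continuous ?_)
    rintro _ ⟨i, rfl⟩
    exact congrFun huv i
  exact (hcont.measurableEmbedding hinj).measurable_comp_iff.1
    (measurable_pi_lambda _ fun i => hg _)

/-- Consistency of sample average approximation: for i.i.d. data and a dominated Carathéodory
integrand on a compact set, the minimizers of the empirical sums approach those of the
expectation almost surely. -/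
theorem ae_tendsto_infDist_argminSet_integral {X A Ω : Type*} [MetricSpace X] [MeasurableSpace A]
    [MeasurableSpace Ω] {P : Measure Ω} {Y : ℕ → Ω → A}
    (hindep : iIndepFun Y P) (hident : ∀ i, IdentDistrib (Y i) (Y 0) P P)
    {K : Set X} (hK : IsCompact K) {F : X → A → ℝ}
    (hcont : ∀ y, ContinuousOn (fun x => F x y) K) (hmeas : ∀ x ∈ K, Measurable (F x))
    {B : A → ℝ} (hB : Integrable (fun ω => B (Y 0 ω)) P) (hFB : ∀ x ∈ K, ∀ y, |F x y| ≤ B y)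
    (hB0 : ∀ y, 0 ≤ B y) :
    ContinuousOn (fun x => ∫ ω, F x (Y 0 ω) ∂P) K ∧
    ∀ᵐ ω ∂P, ∀ x : ℕ → X,
      (∀ N, x N ∈ argminSet (fun x => ∑ i ∈ Finset.range N, F x (Y i ω)) K) →
      Tendsto (fun N => Metric.infDist (x N) (argminSet (fun x => ∫ ω, F x (Y 0 ω) ∂P) K))
        atTop (𝓝 0) := by
  have : CompactSpace K := isCompact_iff_compactSpace.1 hK
  borelize C(K, ℝ)
  let g : A → C(K, ℝ) := fun y => ⟨fun x => F x y, (hcont y).domRestrict⟩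
  have hg : Measurable g := by
    have := measurable_continuousMap_of_eval (g := g) fun x => hmeas x x.2
    rwa [← BorelSpace.measurable_eq (α := C(K, ℝ))] at this
  have hint : Integrable (fun ω => g (Y 0 ω)) P := by
    refine hB.mono' (hg.comp_aemeasurable (hident 0).aemeasurable_fst).aestronglyMeasurable
      (Eventually.of_forall fun ω => ?_)
    exact (ContinuousMap.norm_le _ (hB0 _)).2 fun x => hFB x x.2 _
  have heval : ∀ x : K, (∫ ω, g (Y 0 ω) ∂P) x = ∫ ω, F x (Y 0 ω) ∂P := fun x =>
    ((ContinuousMap.evalCLM ℝ x).integral_comp_comm hint).symm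
  have hcontE : ContinuousOn (fun x => ∫ ω, F x (Y 0 ω) ∂P) K := by
    rw [continuousOn_iff_continuous_domRestrict]
    exact (∫ ω, g (Y 0 ω) ∂P).continuous.congr heval
  refine ⟨hcontE, ?_⟩
  -- The strong law for `C(K, ℝ)`-valued variables: norm convergence there is uniform convergence on
  -- `K`.
  filter_upwards [strong_law_ae (fun i ω => g (Y i ω)) hint
    (fun i j hij => (hindep.indepFun hij).comp hg hg) (fun i => (hident i).comp hg)]
    with ω hω x hx
  have hunif : TendstoUniformlyOn
      (fun (N : ℕ) x => (N : ℝ)⁻¹ * ∑ i ∈ Finset.range N, F x (Y i ω))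
      (fun x => ∫ ω, F x (Y 0 ω) ∂P) atTop K := by
    rw [tendstoUniformlyOn_iff_tendstoUniformly_comp_coe]
    convert ContinuousMap.tendsto_iff_tendstoUniformly.1 hω using 1
    · funext N x
      simp only [ContinuousMap.smul_apply, ContinuousMap.sum_apply, smul_eq_mul]
      rfl
    · funext x
      exact (heval x).symm
  refine tendsto_infDist_argminSet hK hcontE hunif fun N => ?_
  rcases N.eq_zero_or_pos with rfl | hN
  -- For `N = 0` the sum is empty, so both objectives vanish and the factor `0⁻¹` is harmless.
  · simpa [argminSet] using hx 0
  · rw [argminSet_const_mul (by positivity)]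
    exact hx N

/-! ### Tree regions and costs restricted to a leaf -/

namespace DecisionTree

theorem measurable_leafIndex {s : ℕ} (t : DecisionTree s) : Measurable t.leafIndex := by
  induction t with
  | leaf => exact measurable_const
  | node j c l r hl hr =>
    exact Measurable.ite (measurableSet_le (measurable_pi_apply j) measurable_const) hl
      (hr.const_add _)

theorem measurableSet_region {s : ℕ} (t : DecisionTree s) (ℓ : Fin t.numLeaves) :
    MeasurableSet (t.region ℓ) :=
  t.measurable_leafIndex (measurableSet_singleton (ℓ : ℕ))

end DecisionTree

namespace TwoStage

variable {n m k s d : ℕ} {M : TwoStage n m k}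

theorem continuousOn_policyCost_param (hU : M.dualSet.Nonempty)
    (hb : Bornology.IsBounded M.dualSet) (hZ : IsCompact M.Z) (hf : ContinuousOn M.f M.Z)
    {S : Set (Scenario m n)} (hS : ∀ ξ ∈ S, ∃! z, z ∈ M.oneScenarioSolutions ξ)
    {Θ : Set (EuclideanSpace ℝ (Fin d))}
    {Ψ : EuclideanSpace ℝ (Fin d) → (Fin s → ℝ) → Scenario m n}
    (hmem : ∀ θ ∈ Θ, ∀ x, Ψ θ x ∈ S) (hΨ : ∀ x, ContinuousOn (fun θ => Ψ θ x) Θ)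
    (o : Obs s m n) : ContinuousOn (fun θ => M.policyCost Ψ θ o) Θ :=
  (continuousOn_G hU hb hf).comp
    (((continuousOn_zD hU hb hZ hf hS).comp (hΨ o.1) fun θ hθ => hmem θ hθ _).prodMk
      continuousOn_const)
    fun θ hθ => ⟨(zD_mem (hS _ (hmem θ hθ _))).1, trivial⟩

theorem continuous_policyCost (hU : M.dualSet.Nonempty)
    (hb : Bornology.IsBounded M.dualSet) (hZ : IsCompact M.Z) (hf : ContinuousOn M.f M.Z)
    {S : Set (Scenario m n)} (hS : ∀ ξ ∈ S, ∃! z, z ∈ M.oneScenarioSolutions ξ)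
    {Ψ : EuclideanSpace ℝ (Fin d) → (Fin s → ℝ) → Scenario m n}
    {θ : EuclideanSpace ℝ (Fin d)} (hmem : ∀ x, Ψ θ x ∈ S) (hΨ : Continuous (Ψ θ)) :
    Continuous (M.policyCost Ψ θ) :=
  (continuousOn_G hU hb hf).comp_continuous
    (((continuousOn_zD hU hb hZ hf hS).comp_continuous (hΨ.comp continuous_fst)
      fun _ => hmem _).prodMk continuous_snd)
    fun _ => ⟨(zD_mem (hS _ (hmem _))).1, trivial⟩

/-- The cost of a policy on the observations that belong to a leaf, and zero elsewhere. -/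
noncomputable def leafCost (M : TwoStage n m k) (Ψ : EuclideanSpace ℝ (Fin d) → (Fin s → ℝ) → Scenario m n)
    (t : DecisionTree s) (ℓ : Fin t.numLeaves) (θ : EuclideanSpace ℝ (Fin d)) :
    Obs s m n → ℝ :=
  (Prod.fst ⁻¹' t.region ℓ).indicator (M.policyCost Ψ θ)

theorem sum_leafSample (Ψ : EuclideanSpace ℝ (Fin d) → (Fin s → ℝ) → Scenario m n)
    (t : DecisionTree s) (ℓ : Fin t.numLeaves) (o : ℕ → Obs s m n) (N : ℕ)
    (θ : EuclideanSpace ℝ (Fin d)) :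
    ∑ i ∈ t.leafSample ℓ o N, M.policyCost Ψ θ (o i) =
      ∑ i ∈ Finset.range N, M.leafCost Ψ t ℓ θ (o i) := by
  classical
  rw [DecisionTree.leafSample, Finset.sum_filter]
  refine Finset.sum_congr rfl fun i _ => ?_
  simp only [leafCost, Set.indicator_apply, Set.mem_preimage, DecisionTree.region,
    Set.mem_ofPred_eq]

theorem argminSet_leafObjective (Ψ : EuclideanSpace ℝ (Fin d) → (Fin s → ℝ) → Scenario m n)
    (t : DecisionTree s) (ℓ : Fin t.numLeaves) (o : ℕ → Obs s m n) (N : ℕ)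
    (Θ : Set (EuclideanSpace ℝ (Fin d))) :
    argminSet (M.leafObjective Ψ t ℓ o N) Θ =
      argminSet (fun θ => ∑ i ∈ Finset.range N, M.leafCost Ψ t ℓ θ (o i)) Θ := by
  simp only [← sum_leafSample]
  rcases (t.leafSample ℓ o N).eq_empty_or_nonempty with h | h
  -- On an empty leaf both objectives are zero, so every point of `Θ` is a minimizer.
  · exact argminSet_congr fun θ _ => by simp [leafObjective, h]
  · exact argminSet_const_mul (one_div_pos.2 (Nat.cast_pos.2 h.card_pos))

/-- Conditioning only restricts and rescales `P`, and the factor does not depend on `θ`. -/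
theorem regionCost_eq {Ω : Type*} [MeasurableSpace Ω] {P : Measure Ω} {Y : Ω → Obs s m n}
    (hY : AEMeasurable Y P) (Ψ : EuclideanSpace ℝ (Fin d) → (Fin s → ℝ) → Scenario m n)
    (t : DecisionTree s) (ℓ : Fin t.numLeaves) (θ : EuclideanSpace ℝ (Fin d)) :
    M.regionCost P Y Ψ t ℓ θ =
      ((P {ω | (Y ω).1 ∈ t.region ℓ})⁻¹).toReal * ∫ ω, M.leafCost Ψ t ℓ θ (Y ω) ∂P := by
  have hnull : NullMeasurableSet {ω | (Y ω).1 ∈ t.region ℓ} P :=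
    hY.nullMeasurable (measurable_fst (t.measurableSet_region ℓ))
  rw [regionCost, ProbabilityTheory.cond, integral_smul_measure, smul_eq_mul,
    ← integral_indicator₀ hnull]
  rfl

end TwoStage

theorem proposition4 {n m k s d : ℕ}
    -- the two-stage program
    (M : TwoStage n m k)
    (hZ_convex : Convex ℝ M.Z) (hZ_closed : IsClosed M.Z)
    (hf_convex : ConvexOn ℝ M.dom M.f) (hZ_dom : M.Z ⊆ M.dom) (hf_cont : ContinuousOn M.f M.Z)
    -- non-empty feasibility set, non-empty relative interior of the domain
    (hZ_nonempty : M.Z.Nonempty) (hri : (intrinsicInterior ℝ M.dom).Nonempty)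
    -- boundedness of the primal and dual feasibility sets
    (hZ_bounded : Bornology.IsBounded M.Z)
    (hU_nonempty : M.dualSet.Nonempty) (hU_bounded : Bornology.IsBounded M.dualSet)
    -- unique one-scenario solutions on the scenario space
    (𝒮 : Set (Scenario m n))
    (hunique : ∀ ξ ∈ 𝒮, ∃! z, z ∈ M.oneScenarioSolutions ξ)
    -- parameters and forecast function
    (Θ : Set (EuclideanSpace ℝ (Fin d))) (hΘ_compact : IsCompact Θ) (hΘ_nonempty : Θ.Nonempty)
    (Ψ : EuclideanSpace ℝ (Fin d) → (Fin s → ℝ) → Scenario m n)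
    (hΨ_mem : ∀ θ ∈ Θ, ∀ x, Ψ θ x ∈ 𝒮)
    (hΨ_param : ∀ x, ContinuousOn (fun θ => Ψ θ x) Θ)
    (hΨ_feature : ∀ θ ∈ Θ, Continuous (Ψ θ))
    -- the i.i.d. data process, with integrable scenarios
    {Ω : Type*} [MeasurableSpace Ω] (P : Measure Ω) [IsProbabilityMeasure P]
    (Y : ℕ → Ω → Obs s m n)
    (hY_indep : iIndepFun Y P) (hY_ident : ∀ i, IdentDistrib (Y i) (Y 0) P P)
    (hξ_int : Integrable (fun ω => (Y 0 ω).2) P)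
    -- the fixed tree, and the finite i.i.d. sample used for its construction
    (t : DecisionTree s)
    {Ω₀ : Type*} [MeasurableSpace Ω₀] (P₀ : Measure Ω₀) [IsProbabilityMeasure P₀]
    (N₀ : ℕ) (C : Fin N₀ → Ω₀ → Obs s m n)
    (hC_indep : iIndepFun C P₀) (hC_ident : ∀ i, IdentDistrib (C i) (Y 0) P₀ P)
    -- the trained leaf parameters
    (θs : Fin t.numLeaves → ℕ → Ω → EuclideanSpace ℝ (Fin d))
    (hθs : ∀ᵐ ω ∂P, ∀ ℓ N,
      θs ℓ N ω ∈ argminSet (M.leafObjective Ψ t ℓ (fun i => Y i ω) N) Θ) :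
    -- for almost every realization of the construction sample and every leaf that received
    -- one of its observations:
    ∀ᵐ ω₀ ∂P₀, ∀ ℓ : Fin t.numLeaves, (∃ i, (C i ω₀).1 ∈ t.region ℓ) →
      -- the conditional expected cost is well defined and has minimizers
      0 < P {ω | (Y 0 ω).1 ∈ t.region ℓ} ∧
      (∀ θ ∈ Θ, Integrable (fun ω => M.policyCost Ψ θ (Y 0 ω))
        (P[|{ω | (Y 0 ω).1 ∈ t.region ℓ}])) ∧
      (argminSet (M.regionCost P (Y 0) Ψ t ℓ) Θ).Nonempty ∧
      -- convergence of the leaf parameters, with probability 1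
      ∀ᵐ ω ∂P, Tendsto
        (fun N => Metric.infDist (θs ℓ N ω) (argminSet (M.regionCost P (Y 0) Ψ t ℓ) Θ))
        atTop (𝓝 0) := by
  have hZ : IsCompact M.Z := Metric.isCompact_of_isClosed_isBounded hZ_closed hZ_bounded
  have hY0 : AEMeasurable (Y 0) P := (hY_ident 0).aemeasurable_fst
  have hpos : ∀ᵐ ω₀ ∂P₀, ∀ ℓ : Fin t.numLeaves, (∃ i, (C i ω₀).1 ∈ t.region ℓ) →
      0 < P {ω | (Y 0 ω).1 ∈ t.region ℓ} := by
    refine ae_all_iff.2 fun ℓ => ?_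
    rcases eq_or_ne (P {ω | (Y 0 ω).1 ∈ t.region ℓ}) 0 with h0 | h0
    · have hnone : ∀ᵐ ω₀ ∂P₀, ∀ i, (C i ω₀).1 ∉ t.region ℓ := by
        refine ae_all_iff.2 fun i => ?_
        have h1 : P₀ {ω₀ | (C i ω₀).1 ∈ t.region ℓ} = 0 :=
          ((hC_ident i).measure_mem_eq (measurable_fst (t.measurableSet_region ℓ))).trans h0
        exact measure_eq_zero_iff_ae_notMem.1 h1
      filter_upwards [hnone] with ω₀ hω₀ ⟨i, hi⟩
      exact absurd hi (hω₀ i)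
    · exact Eventually.of_forall fun _ _ => pos_iff_ne_zero.2 h0
  filter_upwards [hpos] with ω₀ hω₀ ℓ hℓ
  have hP := hω₀ ℓ hℓ
  obtain ⟨a, c, hac⟩ := TwoStage.exists_abs_G_le hU_nonempty hU_bounded hZ hf_cont
  -- Absolute values make the envelope non-negative, since the signs of `a` and `c` are not known.
  let B : Obs s m n → ℝ := fun o => |a| + |c| * ‖o.2‖
  have hB : Integrable (fun ω => B (Y 0 ω)) P :=
    (integrable_const _).add (hξ_int.norm.const_mul _)
  have hB0 : ∀ o, 0 ≤ B o := fun o => by positivity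
  have hbound : ∀ θ ∈ Θ, ∀ o, |M.policyCost Ψ θ o| ≤ B o := fun θ hθ o =>
    (hac _ (TwoStage.zD_mem (hunique _ (hΨ_mem θ hθ o.1))).1 o.2).trans
      (add_le_add (le_abs_self a) (mul_le_mul_of_nonneg_right (le_abs_self c) (norm_nonneg _)))
  have hmeas : ∀ θ ∈ Θ, Measurable (M.policyCost Ψ θ) := fun θ hθ =>
    (TwoStage.continuous_policyCost hU_nonempty hU_bounded hZ hf_cont hunique (hΨ_mem θ hθ)
      (hΨ_feature θ hθ)).measurable
  have hregion : MeasurableSet (Prod.fst ⁻¹' t.region ℓ : Set (Obs s m n)) :=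
    measurable_fst (t.measurableSet_region ℓ)
  obtain ⟨hcont, hlim⟩ := ae_tendsto_infDist_argminSet_integral hY_indep hY_ident hΘ_compact
    (F := M.leafCost Ψ t ℓ) (B := B)
    (fun o => by
      by_cases ho : o ∈ (Prod.fst ⁻¹' t.region ℓ : Set (Obs s m n))
      · simpa only [TwoStage.leafCost, Set.indicator_of_mem ho] using
          TwoStage.continuousOn_policyCost_param hU_nonempty hU_bounded hZ hf_cont hunique hΨ_mem
            hΨ_param o
      · simpa only [TwoStage.leafCost, Set.indicator_of_notMem ho] using continuousOn_const)
    (fun θ hθ => (hmeas θ hθ).indicator hregion) hB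
    (fun θ hθ o => (norm_indicator_le_norm_self (M.policyCost Ψ θ) o).trans (hbound θ hθ o)) hB0
  have hargmin : argminSet (M.regionCost P (Y 0) Ψ t ℓ) Θ =
      argminSet (fun θ => ∫ ω, M.leafCost Ψ t ℓ θ (Y 0 ω) ∂P) Θ := by
    rw [argminSet_congr fun θ _ => TwoStage.regionCost_eq hY0 Ψ t ℓ θ]
    exact argminSet_const_mul (ENNReal.toReal_pos (ENNReal.inv_ne_zero.2 (measure_ne_top _ _))
      (ENNReal.inv_ne_top.2 hP.ne'))
  refine ⟨hP, fun θ hθ => ?_, ?_, ?_⟩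
  · have hint : Integrable (fun ω => M.policyCost Ψ θ (Y 0 ω)) P :=
      hB.mono' ((hmeas θ hθ).comp_aemeasurable hY0).aestronglyMeasurable
        (Eventually.of_forall fun ω => hbound θ hθ _)
    exact hint.restrict.smul_measure (ENNReal.inv_ne_top.2 hP.ne')
  · rw [hargmin]
    exact argminSet_nonempty hΘ_compact hΘ_nonempty hcont
  · rw [hargmin]
    -- The null set in `hlim` serves all sequences of minimizers at once, so `θs` need not be
    -- measurable in `ω`.
    filter_upwards [hlim, hθs] with ω hω hθω
    refine hω _ fun N => ?_
    rw [← TwoStage.argminSet_leafObjective]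
    exact hθω ℓ N
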